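/- Let $\mathbb D=\{z\in\mathbb C:|z|<1\}$ and $\mathbb T=\{\zeta\in\mathbb C:|\zeta|=1\}$, and let $\mathcal D_a$ be the space of functions that are analytic on $\mathbb D$ and smooth on $\overline{\mathbb D}$. Let $\lambda$ be arc length measure on $\mathbb T$, normalized so that $\lambda(\mathbb T)=1$. For $f\in\mathcal D_a$ and $k\ge 0$ put $\hat f(k)=\int_{\mathbb T}f(\zeta)\overline{\zeta}^{\,k}\,d\lambda(\zeta)$. For a finite positive Borel measure $\mu$ on $\mathbb T$ let $P_\mu(z)=\int_{\mathbb T}\frac{1-|z|^2}{|\zeta-z|^2}\,d\mu(\zeta)$, $z\in\mathbb D$, be its Poisson extension, and for $f\in\mathcal D_a$ define the weighted Dirichlet integrals $$\mathcal D_{\mu,0}(f)=\lim_{r\to1^-}\int_{\mathbb T}|f(r\zeta)|^2P_\mu(r\zeta)\,d\lambda(\zeta),$$ $$\mathcal D_{\mu,n}(f)=\lim_{r\to1^-}\frac{1}{n!(n-1)!\,\pi}\int_{r\mathbb D}|f^{(n)}(z)|^2P_\mu(z)(1-|z|^2)^{n-1}\,dA(z),\qquad n\ge1,$$ where $A$ is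 area measure. **Proposition 4.5.** Let $\mu$ be a nonzero finite positive Borel measure on $\mathbb T$. For every $f\in\mathcal D_a$, the limits defining $\mathcal D_{\lambda,n}(f)$ for $n\ge0$ and $\mathcal D_{\mu,n}(f)$ for $n\ge1$ exist and are finite, and the following hold. (i) For every integer $n\ge0$ there is a constant $C>0$, depending only on $\mu$ and $n$, such that for all $f\in\mathcal D_a$ $$\mathcal D_{\lambda,n}(f)\le C\left(|\hat f(n)|^2+\mathcal D_{\mu,n+1}(f)\right).$$ (ii) For every integer $n\ge1$ there are constants $C,c_1,c_2>0$, depending only on $\mu$ and $n$, such that for all $f\in\mathcal D_a$ $$\mathcal D_{\mu,n}(f)\le C\left(|\hat f(n)|^2+\mathcal D_{\lambda,n+1}(f)\right)$$ and $$c_1\left(\mathcal D_{\lambda,n}(f)+\mathcal D_{\lambda,n+1}(f)\right)\le|\hat f(n)|^2+\mathcal D_{\lambda,n+1}(f)\le c_2\left(\mathcal D_{\lambda,n}(f)+\mathcal D_{\lambda,n+1}(f)\right).$$ -/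

import Mathlib

open Complex Filter Topology MeasureTheory Metric
open scoped ContDiff Nat

/-- `SmoothAnalytic f` : the function `f` is analytic on the open unit disc and smooth on the closed
unit disc (only the values of `f` on the closed disc matter). -/
def SmoothAnalytic (f : ℂ → ℂ) : Prop :=
  DifferentiableOn ℂ f (ball 0 1) ∧ ContDiffOn ℝ ∞ f (closedBall 0 1)

/-- The Fourier coefficient `(1 / 2π) ∫_𝕋 f(ζ) conj(ζ)^k dλ(ζ)`, where `dλ` is arc length. -/
noncomputable def circleCoeff (f : ℂ → ℂ) (k : ℕ) : ℂ :=
  Real.circleAverage (fun ζ => f ζ * (starRingEnd ℂ ζ) ^ k) 0 1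

/-- Arc length measure on the unit circle `𝕋 = sphere 0 1`, normalized to total mass one, as the
image of normalized Lebesgue measure on `(-π, π]` under `θ ↦ exp (i θ)`. It is the measure that
represents `λ` as a distribution: its Poisson extension is identically `1`. -/
noncomputable def normArcLength : Measure (sphere (0 : ℂ) 1) :=
  ENNReal.ofReal (1 / (2 * Real.pi)) •
    (volume.restrict (Set.Ioc (-Real.pi) Real.pi)).map
      (fun θ : ℝ => (⟨exp (θ * I), by simp [norm_exp_ofReal_mul_I]⟩ : sphere (0 : ℂ) 1))

/-- The Poisson extension `P_μ(z) = ∫_𝕋 (1 - |z|²) / |ζ - z|² dμ(ζ)` of a measure on the circle. -/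
noncomputable def poissonExt (μ : Measure (sphere (0 : ℂ) 1)) (z : ℂ) : ℝ :=
  ∫ ζ, (1 - ‖z‖ ^ 2) / ‖(ζ : ℂ) - z‖ ^ 2 ∂μ

/-- The quantity whose limit as `r → 1⁻` is the weighted Dirichlet integral of order `n`:
for `n = 0` it is `(1 / 2πr) ∫_{r𝕋} |f|² P_μ dλ`, and for `n ≥ 1` it is
`(1 / (n! (n-1)! π)) ∫_{r𝔻} |f⁽ⁿ⁾(z)|² P_μ(z) (1 - |z|²)^(n-1) dA(z)`. -/
noncomputable def dirichletTrunc (μ : Measure (sphere (0 : ℂ) 1)) (n : ℕ) (f : ℂ → ℂ) (r : ℝ) : ℝ :=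
  match n with
  | 0 => Real.circleAverage (fun ζ => ‖f ζ‖ ^ 2 * poissonExt μ ζ) 0 r
  | m + 1 => 1 / ((m + 1)! * m ! * Real.pi) *
      ∫ z in ball (0 : ℂ) r,
        ‖iteratedDeriv (m + 1) f z‖ ^ 2 * poissonExt μ z * (1 - ‖z‖ ^ 2) ^ m

/-- The weighted Dirichlet integral `D_{μ,n}(f)` of order `n`, the limit of `dirichletTrunc μ n f r`
as `r → 1⁻`. -/
noncomputable def dirichletInt (μ : Measure (sphere (0 : ℂ) 1)) (n : ℕ) (f : ℂ → ℂ) : ℝ :=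
  limUnder (𝓝[<] (1 : ℝ)) (dirichletTrunc μ n f)

/-! Everything is read off the Taylor coefficients a_k of f, which are also its Fourier coefficients
(`SmoothAnalytic.circleCoeff_eq`). Since P_λ = 1, Parseval on circles and the moments of (1 - ρ²)^m
give D_{λ,n}(f) = Σ_k binom(k+n, n) |a_{k+n}|², with weights of order k^n. In the comparison of
D_{·,n} with D_{·,n+1}, the only coefficient that the higher order integral does not see is a_n, and
the term |f̂(n)|² supplies it; `le_of_weighted_sums` is this bookkeeping.

For (i), P_μ(z) ≥ (μ(𝕋)/4)(1 - |z|²), so D_{μ,n+1} dominates the integral of |f⁽ⁿ⁺¹⁾|² against (1 -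
|z|²)^(n+1), whose coefficient weights are again of order k^n.

For the first bound in (ii) with n ≥ 2, P_μ(z) ≤ 4μ(𝕋)/(1 - |z|²) costs one power of 1 - |z|² and
yields weights of order k^(n+1). For n = 1 there is no power to spend. Instead |f'| is replaced by
its radial majorant Σ (k+1)|a_{k+1}|ρ^k; the average of P_μ over every circle is μ(𝕋), and Hilbert's
inequality bounds the radial integral that remains by Σ (k+1)²|a_{k+1}|²
(`lintegral_norm_sq_mul_poissonExt_le`).

The comparability in (ii) follows from the coefficient formula alone. Sums and integrals are taken
in `ℝ≥0∞`, where they can be interchanged without convergence hypotheses. -/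

open scoped ENNReal

/-! ### Taylor coefficients and Parseval's identity on circles -/

/-- The `k`-th Taylor coefficient of `g` at the origin. -/
noncomputable def taylorCoeff (g : ℂ → ℂ) (k : ℕ) : ℂ := (k ! : ℂ)⁻¹ * iteratedDeriv k g 0

lemma hasSum_taylorCoeff {g : ℂ → ℂ} (hg : DifferentiableOn ℂ g (ball 0 1)) {z : ℂ}
    (hz : ‖z‖ < 1) : HasSum (fun k => taylorCoeff g k * z ^ k) (g z) := by
  have h := hasSum_taylorSeries_on_ball hg (z := z) (by simpa using hz)
  simp only [sub_zero, smul_eq_mul] at h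
  have he : (fun k => taylorCoeff g k * z ^ k) =
      fun k => (k ! : ℂ)⁻¹ * (z ^ k * iteratedDeriv k g 0) := funext fun k => by
    rw [taylorCoeff]
    ring
  rwa [he]

/-- Convergence at a radius s with ρ < s < 1 makes the terms at s bounded, and the ratio ρ / s then
gives a geometric majorant. -/
lemma summable_norm_taylorCoeff {g : ℂ → ℂ} (hg : DifferentiableOn ℂ g (ball 0 1)) {ρ : ℝ}
    (h0 : 0 ≤ ρ) (h1 : ρ < 1) : Summable (fun k => ‖taylorCoeff g k‖ * ρ ^ k) := by
  obtain ⟨s, hs, hs1⟩ := exists_between h1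
  have hs0 : 0 < s := h0.trans_lt hs
  have h := (hasSum_taylorCoeff hg (z := (s : ℂ)) (by simpa [abs_of_pos hs0] using hs1)).summable
  obtain ⟨M, hM⟩ := h.tendsto_atTop_zero.norm.bddAbove_range
  have hM' : ∀ k, ‖taylorCoeff g k‖ * s ^ k ≤ M := fun k => by
    simpa [abs_of_pos hs0] using hM (Set.mem_range_self k)
  refine Summable.of_nonneg_of_le (fun k => by positivity) (fun k => ?_)
    ((summable_geometric_of_lt_one (r := ρ / s) (by positivity)
      ((div_lt_one hs0).2 hs)).mul_left M)
  calc ‖taylorCoeff g k‖ * ρ ^ k = ‖taylorCoeff g k‖ * s ^ k * (ρ / s) ^ k := by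
        rw [div_pow]; field_simp
    _ ≤ M * (ρ / s) ^ k := by gcongr; exact hM' k

/-- Parseval for polynomials, applied to the Taylor sections, passes to the limit by dominated
convergence; the majorant is the square of the absolutely convergent sum. -/
lemma hasSum_circleAverage_norm_sq {g : ℂ → ℂ} (hg : DifferentiableOn ℂ g (ball 0 1)) {ρ : ℝ}
    (h0 : 0 ≤ ρ) (h1 : ρ < 1) :
    HasSum (fun k => ‖taylorCoeff g k‖ ^ 2 * ρ ^ (2 * k))
      (Real.circleAverage (fun z => ‖g z‖ ^ 2) 0 ρ) := by
  set a : ℕ → ℂ := fun k => taylorCoeff g k * (ρ : ℂ) ^ k with ha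
  have hna : ∀ k, ‖a k‖ = ‖taylorCoeff g k‖ * ρ ^ k := fun k => by simp [ha, abs_of_nonneg h0]
  have hsum : Summable fun k => ‖a k‖ := by
    simpa only [hna] using summable_norm_taylorCoeff hg h0 h1
  -- The radius is absorbed into the coefficients, so that the unit circle for `p N` corresponds to
  -- the circle of radius ρ for g.
  let p : ℕ → Polynomial ℂ := fun N => ∑ k ∈ Finset.range N, Polynomial.monomial k (a k)
  have hcoeff : ∀ N k, (p N).coeff k = if k < N then a k else 0 := fun N k => by
    simp [p, Polynomial.finsetSum_coeff, Polynomial.coeff_monomial]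
  have hpar : ∀ N, ∑ k ∈ Finset.range N, ‖taylorCoeff g k‖ ^ 2 * ρ ^ (2 * k) =
      Real.circleAverage (fun z => ‖(p N).eval z‖ ^ 2) 0 1 := fun N => by
    rw [← Polynomial.sum_sq_norm_coeff_eq_circleAverage]
    symm
    calc ∑ i ∈ (p N).support, ‖(p N).coeff i‖ ^ 2
        = ∑ i ∈ Finset.range N, ‖(p N).coeff i‖ ^ 2 := by
          refine Finset.sum_subset (fun i hi => ?_) (fun i _ hi => ?_)
          · rw [Polynomial.mem_support_iff, hcoeff] at hi
            by_contra h
            exact hi (if_neg fun h' => h (Finset.mem_range.2 h'))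
          · rw [Polynomial.notMem_support_iff.1 hi]; simp
      _ = _ := Finset.sum_congr rfl fun i hi => by
          rw [hcoeff, if_pos (Finset.mem_range.1 hi), hna, mul_pow, ← pow_mul, mul_comm i 2]
  have hlim : Tendsto (fun N => Real.circleAverage (fun z => ‖(p N).eval z‖ ^ 2) 0 1) atTop
      (𝓝 (Real.circleAverage (fun z => ‖g z‖ ^ 2) 0 ρ)) := by
    simp only [Real.circleAverage_def]
    refine Tendsto.const_smul ?_ _
    refine intervalIntegral.tendsto_integral_filter_of_dominated_convergence
      (fun _ => (∑' k, ‖a k‖) ^ 2) (Eventually.of_forall fun N => ?_)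
      (Eventually.of_forall fun N => Eventually.of_forall fun θ _ => ?_) (by simp)
      (Eventually.of_forall fun θ _ => ?_)
    · exact Continuous.aestronglyMeasurable (by fun_prop)
    · rw [Real.norm_of_nonneg (by positivity)]
      gcongr
      calc ‖(p N).eval (circleMap 0 1 θ)‖ ≤ ∑ k ∈ Finset.range N, ‖a k‖ := by
            simp only [p, Polynomial.eval_finsetSum, Polynomial.eval_monomial]
            refine (norm_sum_le _ _).trans_eq (Finset.sum_congr rfl fun k _ => ?_)
            simp
        _ ≤ ∑' k, ‖a k‖ := hsum.sum_le_tsum _ fun _ _ => norm_nonneg _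
    · have h := (hasSum_taylorCoeff hg (z := circleMap 0 ρ θ)
        (by simpa [abs_of_nonneg h0] using h1)).tendsto_sum_nat
      refine (h.norm.pow 2).congr fun N => ?_
      simp only [p, Polynomial.eval_finsetSum, Polynomial.eval_monomial, ha, circleMap, zero_add,
        mul_pow, ofReal_one, one_mul, mul_assoc]
  rw [hasSum_iff_tendsto_nat_of_nonneg (fun k => by positivity)]
  simpa only [hpar] using hlim

/-! ### Polar coordinates and radial weights -/

/-- The integral of a nonnegative function over a circle as a lower Lebesgue integral. -/
lemma lintegral_circle {F : ℂ → ℝ} {ρ : ℝ} (hF : ContinuousOn F (sphere 0 |ρ|))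
    (h0 : ∀ z ∈ sphere (0 : ℂ) |ρ|, 0 ≤ F z) :
    ∫⁻ θ in Set.Ioo (-Real.pi) Real.pi, ENNReal.ofReal (F (circleMap 0 ρ θ)) =
      ENNReal.ofReal (2 * Real.pi) * ENNReal.ofReal (Real.circleAverage F 0 ρ) := by
  have hc : Continuous fun θ => F (circleMap 0 ρ θ) :=
    hF.comp_continuous (by fun_prop) fun θ => circleMap_mem_sphere' _ _ _
  rw [← ENNReal.ofReal_mul (by positivity), Real.circleAverage_eq_integral_add (-Real.pi),
    intervalIntegral.integral_comp_add_right (fun θ => F (circleMap 0 ρ θ)), smul_eq_mul,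
    mul_inv_cancel_left₀ (by positivity), zero_add,
    show 2 * Real.pi + -Real.pi = Real.pi by ring,
    intervalIntegral.integral_of_le (by linarith [Real.pi_pos]), integral_Ioc_eq_integral_Ioo,
    ofReal_integral_eq_lintegral_ofReal]
  · exact (hc.continuousOn.integrableOn_Icc).mono_set Set.Ioo_subset_Icc_self
  · exact Eventually.of_forall fun θ => h0 _ (circleMap_mem_sphere' _ _ _)

/-- Integration over the unit disc in polar coordinates. -/
lemma lintegral_unitDisc (F : ℂ → ℝ≥0∞) (hF : Measurable F) :
    ∫⁻ z in ball (0 : ℂ) 1, F z = ∫⁻ ρ in Set.Ioo (0 : ℝ) 1,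
      ENNReal.ofReal ρ * ∫⁻ θ in Set.Ioo (-Real.pi) Real.pi, F (circleMap 0 ρ θ) := by
  have hm : Measurable fun p : ℝ × ℝ => circleMap 0 p.1 p.2 := by
    unfold circleMap; fun_prop
  rw [← lintegral_indicator measurableSet_ball, ← Complex.lintegral_comp_polarCoord_symm,
    ← lintegral_indicator measurableSet_Ioo]
  have hsymm : ∀ p : ℝ × ℝ, Complex.polarCoord.symm p = circleMap 0 p.1 p.2 := fun p => by
    rw [Complex.polarCoord_symm_apply, circleMap, Complex.exp_mul_I]; simp
  simp only [hsymm, polarCoord_target, smul_eq_mul]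
  rw [Measure.volume_eq_prod, ← Measure.prod_restrict, lintegral_prod]
  · rw [← lintegral_indicator measurableSet_Ioi]
    refine lintegral_congr fun ρ => ?_
    by_cases h0 : 0 < ρ
    · by_cases h1 : ρ < 1
      · rw [Set.indicator_of_mem (Set.mem_Ioi.2 h0), Set.indicator_of_mem (Set.mem_Ioo.2 ⟨h0, h1⟩),
          ← lintegral_const_mul _
            (show Measurable fun θ => F (circleMap 0 ρ θ) from hF.comp (by fun_prop))]
        refine lintegral_congr fun θ => ?_
        rw [Set.indicator_of_mem (by simpa [abs_of_pos h0] using h1)]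
      · rw [Set.indicator_of_mem (Set.mem_Ioi.2 h0),
          Set.indicator_of_notMem (fun h => h1 h.2)]
        refine (lintegral_congr fun θ => ?_).trans lintegral_zero
        rw [Set.indicator_of_notMem (by simpa [abs_of_pos h0] using h1), mul_zero]
    · rw [Set.indicator_of_notMem (by simpa using h0),
        Set.indicator_of_notMem (fun h => h0 h.1)]
  · exact ((ENNReal.measurable_ofReal.comp measurable_fst).mul
      ((hF.indicator measurableSet_ball).comp hm)).aemeasurable

open scoped Classical in
-- Nothing is known about g off the disc, while `lintegral_unitDisc` needs a globally measurable
-- integrand; hence the truncation.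
lemma measurable_indicator_ball {g : ℂ → ℂ} (hg : DifferentiableOn ℂ g (ball 0 1)) :
    Measurable ((ball (0 : ℂ) 1).indicator g) :=
  Set.piecewise_eq_indicator (s := ball (0 : ℂ) 1) (f := g) ▸
    hg.continuousOn.measurable_piecewise continuousOn_const measurableSet_ball

/-- The integral of `|g|²` against a radial weight in terms of Taylor coefficients. -/
lemma lintegral_norm_sq_mul_radial {g : ℂ → ℂ} (hg : DifferentiableOn ℂ g (ball 0 1))
    {w : ℝ → ℝ≥0∞} (hw : Measurable w) :
    ∫⁻ z in ball (0 : ℂ) 1, ENNReal.ofReal (‖g z‖ ^ 2) * w ‖z‖ =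
      ENNReal.ofReal Real.pi * ∑' k, ENNReal.ofReal (‖taylorCoeff g k‖ ^ 2) *
        ∫⁻ ρ in Set.Ioo (0 : ℝ) 1, ENNReal.ofReal (2 * ρ ^ (2 * k + 1)) * w ρ := by
  have hgm := measurable_indicator_ball hg
  calc ∫⁻ z in ball (0 : ℂ) 1, ENNReal.ofReal (‖g z‖ ^ 2) * w ‖z‖
      = ∫⁻ z in ball (0 : ℂ) 1,
          ENNReal.ofReal (‖(ball (0 : ℂ) 1).indicator g z‖ ^ 2) * w ‖z‖ :=
        setLIntegral_congr_fun measurableSet_ball fun z hz => by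
          simp only [Set.indicator_of_mem hz]
    _ = ∫⁻ ρ in Set.Ioo (0 : ℝ) 1, ENNReal.ofReal Real.pi *
          ∑' k, ENNReal.ofReal (‖taylorCoeff g k‖ ^ 2) *
            (ENNReal.ofReal (2 * ρ ^ (2 * k + 1)) * w ρ) := by
        rw [lintegral_unitDisc _ (by fun_prop)]
        refine setLIntegral_congr_fun measurableSet_Ioo fun ρ hρ => ?_
        obtain ⟨h0, h1⟩ := hρ
        have hsub : sphere (0 : ℂ) |ρ| ⊆ ball 0 1 := fun z hz => by
          rw [mem_sphere_zero_iff_norm, abs_of_pos h0] at hz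
          simpa [hz] using h1
        have hcirc := lintegral_circle (F := fun z => ‖g z‖ ^ 2) (ρ := ρ)
          ((hg.continuousOn.mono hsub).norm.pow 2) (fun z _ => by positivity)
        have : ∀ θ, ENNReal.ofReal (‖(ball (0 : ℂ) 1).indicator g (circleMap 0 ρ θ)‖ ^ 2) *
            w ‖circleMap 0 ρ θ‖ = w ρ * ENNReal.ofReal (‖g (circleMap 0 ρ θ)‖ ^ 2) := fun θ => by
          rw [Set.indicator_of_mem (hsub (circleMap_mem_sphere' _ _ _)), mul_comm]
          simp [abs_of_pos h0]
        simp only [this]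
        have hP := hasSum_circleAverage_norm_sq hg h0.le h1
        have hcm : Continuous fun θ => g (circleMap 0 ρ θ) :=
          (hg.continuousOn.mono hsub).comp_continuous (by fun_prop)
            fun θ => circleMap_mem_sphere' _ _ _
        rw [lintegral_const_mul _ (show Measurable fun θ => ENNReal.ofReal (‖g (circleMap 0 ρ θ)‖ ^ 2)
          from (hcm.norm.pow 2).measurable.ennreal_ofReal), hcirc, ← hP.tsum_eq,
          ENNReal.ofReal_tsum_of_nonneg (fun k => by positivity) hP.summable,
          ← ENNReal.tsum_mul_left, ← ENNReal.tsum_mul_left, ← ENNReal.tsum_mul_left,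
          ← ENNReal.tsum_mul_left]
        refine tsum_congr fun k => ?_
        rw [ENNReal.ofReal_mul zero_le_two, ENNReal.ofReal_mul (by positivity),
          ENNReal.ofReal_mul zero_le_two, pow_succ ρ, ENNReal.ofReal_mul (by positivity)]
        ring
    _ = _ := by
        rw [lintegral_const_mul _ (by fun_prop), lintegral_tsum (fun k => by fun_prop)]
        congr 1
        refine tsum_congr fun k => ?_
        rw [lintegral_const_mul _ (by fun_prop)]

/-- Moments of `(1 - ρ²)ᵐ`. -/
lemma integral_pow_mul_one_sub_sq_pow (j m : ℕ) :
    ∫ ρ in (0 : ℝ)..1, 2 * ρ ^ (2 * j + 1) * (1 - ρ ^ 2) ^ m =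
      (j ! * m ! / (j + m + 1)! : ℝ) := by
  induction m generalizing j with
  | zero =>
    simp only [pow_zero, mul_one, intervalIntegral.integral_const_mul, integral_pow]
    rw [add_zero, Nat.factorial_succ]
    have := Nat.factorial_ne_zero j
    push_cast
    field_simp
    simp
    ring
  | succ m ih =>
    -- Splitting off one factor 1 - ρ² gives the recursion I(j, m+1) = I(j, m) - I(j+1, m), which
    -- the factorial quotients satisfy as well.
    have h : ∀ ρ : ℝ, 2 * ρ ^ (2 * j + 1) * (1 - ρ ^ 2) ^ (m + 1) =
        2 * ρ ^ (2 * j + 1) * (1 - ρ ^ 2) ^ m -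
          2 * ρ ^ (2 * (j + 1) + 1) * (1 - ρ ^ 2) ^ m := fun ρ => by ring
    simp only [h]
    rw [intervalIntegral.integral_sub (Continuous.intervalIntegrable (by fun_prop) _ _)
      (Continuous.intervalIntegrable (by fun_prop) _ _), ih, ih,
      show j + 1 + m + 1 = (j + m + 1) + 1 by ring, show j + (m + 1) + 1 = (j + m + 1) + 1 by ring,
      Nat.factorial_succ (j + m + 1), Nat.factorial_succ j, Nat.factorial_succ m]
    have := Nat.factorial_ne_zero (j + m + 1)
    push_cast
    field_simp
    ring

lemma lintegral_pow_mul_one_sub_sq_pow (j m : ℕ) :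
    ∫⁻ ρ in Set.Ioo (0 : ℝ) 1, ENNReal.ofReal (2 * ρ ^ (2 * j + 1)) *
      ENNReal.ofReal ((1 - ρ ^ 2) ^ m) = ENNReal.ofReal (j ! * m ! / (j + m + 1)!) := by
  rw [← integral_pow_mul_one_sub_sq_pow, intervalIntegral.integral_of_le zero_le_one,
    integral_Ioc_eq_integral_Ioo, ofReal_integral_eq_lintegral_ofReal]
  · refine setLIntegral_congr_fun measurableSet_Ioo fun ρ hρ => ?_
    have := hρ.1.le
    rw [← ENNReal.ofReal_mul (by positivity)]
  · exact (Continuous.integrableOn_Icc (by fun_prop)).mono_set Set.Ioo_subset_Icc_self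
  · refine (ae_restrict_iff' measurableSet_Ioo).2 (Eventually.of_forall fun ρ hρ => ?_)
    have h0 := hρ.1.le
    have h1 : 0 ≤ 1 - ρ ^ 2 := by nlinarith [hρ.2]
    simp only [Pi.zero_apply]
    positivity

lemma lintegral_norm_sq_mul_one_sub_sq_pow {g : ℂ → ℂ} (hg : DifferentiableOn ℂ g (ball 0 1))
    (m : ℕ) :
    ∫⁻ z in ball (0 : ℂ) 1, ENNReal.ofReal (‖g z‖ ^ 2) * ENNReal.ofReal ((1 - ‖z‖ ^ 2) ^ m) =
      ENNReal.ofReal Real.pi * ∑' k, ENNReal.ofReal (‖taylorCoeff g k‖ ^ 2 *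
        (k ! * m ! / (k + m + 1)!)) := by
  rw [lintegral_norm_sq_mul_radial hg (w := fun ρ => ENNReal.ofReal ((1 - ρ ^ 2) ^ m))
    (by fun_prop)]
  simp only [lintegral_pow_mul_one_sub_sq_pow]
  congr 1
  refine tsum_congr fun k => ?_
  rw [ENNReal.ofReal_mul (by positivity)]

/-! ### Hilbert's inequality -/

/-- The row estimate for Schur's test on the matrix 1/(j+k+1) with test vector 1/√(k+1). For k ≤ j
the denominator is at least j+1 and the sum of 1/√(k+1) is at most 2√N; for k > j the terms are at
most (k+1)^(-3/2), which telescopes. Each range contributes at most 2/√(j+1). -/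
lemma sum_inv_sqrt_mul_inv_add_le (j N : ℕ) :
    ∑ k ∈ Finset.range N, 1 / (√(k + 1 : ℝ) * (j + k + 1)) ≤ 4 / √(j + 1 : ℝ) := by
  have h1 : ∀ N ≤ j + 1, ∑ k ∈ Finset.range N, 1 / (√(k + 1 : ℝ) * (j + k + 1)) ≤
      2 * √(N : ℝ) / (j + 1) := by
    intro N
    induction N with
    | zero => simp
    | succ N ih =>
      intro hN
      rw [Finset.sum_range_succ]
      have hb : 0 < √(N + 1 : ℝ) := by positivity
      have ha : 0 ≤ √(N : ℝ) := by positivity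
      have hab : √(N : ℝ) ≤ √(N + 1 : ℝ) := Real.sqrt_le_sqrt (by linarith)
      have ha2 := Real.sq_sqrt (show (0 : ℝ) ≤ N by positivity)
      have hb2 := Real.sq_sqrt (show (0 : ℝ) ≤ N + 1 by positivity)
      have h2 : 1 / √(N + 1 : ℝ) ≤ 2 * (√(N + 1 : ℝ) - √(N : ℝ)) := by
        rw [div_le_iff₀ hb]; nlinarith
      calc _ ≤ 2 * √(N : ℝ) / (j + 1) + 1 / √(N + 1 : ℝ) / (j + 1) := by
            rw [div_div]
            gcongr
            · exact ih (by omega)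
            · linarith [(Nat.cast_nonneg N : (0 : ℝ) ≤ N)]
        _ ≤ 2 * √(N : ℝ) / (j + 1) + 2 * (√(N + 1 : ℝ) - √(N : ℝ)) / (j + 1) := by gcongr
        _ = 2 * √((N + 1 : ℕ) : ℝ) / (j + 1) := by push_cast; ring
  have hj : 0 < √(j + 1 : ℝ) := by positivity
  have hj2 := Real.sq_sqrt (show (0 : ℝ) ≤ j + 1 by positivity)
  -- The correction -2/√N carries the telescoping induction; at N = j+1 the bound equals 2/√(j+1),
  -- the value of `h1` there.
  have h2 : ∀ N ≥ j + 1, ∑ k ∈ Finset.range N, 1 / (√(k + 1 : ℝ) * (j + k + 1)) ≤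
      4 / √(j + 1 : ℝ) - 2 / √(N : ℝ) := by
    intro N hN
    induction N, hN using Nat.le_induction with
    | base =>
      refine (h1 _ le_rfl).trans_eq ?_
      push_cast
      generalize √(j + 1 : ℝ) = s at hj hj2 ⊢
      rw [← hj2]
      field_simp
      norm_num
    | succ N hN ih =>
      rw [Finset.sum_range_succ]
      have hN0 : (0 : ℝ) < N := by exact_mod_cast (by omega : 0 < N)
      have hb : 0 < √(N + 1 : ℝ) := by positivity
      have ha : 0 < √(N : ℝ) := by positivity
      have hab : √(N : ℝ) ≤ √(N + 1 : ℝ) := Real.sqrt_le_sqrt (by linarith)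
      have ha2 := Real.sq_sqrt hN0.le
      have hb2 := Real.sq_sqrt (show (0 : ℝ) ≤ N + 1 by positivity)
      have h3 : 1 / (√(N + 1 : ℝ) * (j + N + 1)) ≤ 2 / √(N : ℝ) - 2 / √(N + 1 : ℝ) := by
        calc 1 / (√(N + 1 : ℝ) * (j + N + 1)) ≤ 1 / (√(N + 1 : ℝ) * (N + 1)) := by
              gcongr
              linarith [(Nat.cast_nonneg j : (0 : ℝ) ≤ j)]
          _ ≤ 2 / √(N : ℝ) - 2 / √(N + 1 : ℝ) := by
              generalize √(N : ℝ) = a at *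
              generalize √(N + 1 : ℝ) = b at *
              rw [← hb2]
              have hba : (b - a) * (b + a) = 1 := by nlinarith
              have : b - a = 1 / (b + a) := by field_simp; linarith
              have h4 : 2 / a - 2 / b = 2 * (1 / (b + a)) / (a * b) := by
                rw [← this]; field_simp
              rw [h4, div_le_div_iff₀ (by positivity) (by positivity)]
              have : 2 * (1 / (b + a)) ≥ 1 / b := by
                rw [mul_one_div, ge_iff_le, div_le_div_iff₀ hb (by positivity)]
                linarith
              calc 1 * (a * b) ≤ 1 / b * (b * b ^ 2) := by
                    rw [one_div, inv_mul_cancel_left₀ hb.ne']; nlinarith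
                _ ≤ _ := by gcongr
      push_cast
      linarith
  rcases le_total N (j + 1) with h | h
  · refine (h1 N h).trans ?_
    have : √(N : ℝ) ≤ √(j + 1 : ℝ) := Real.sqrt_le_sqrt (by exact_mod_cast h)
    generalize √(j + 1 : ℝ) = s at hj hj2 this ⊢
    rw [← hj2, div_le_div_iff₀ (by positivity) hj]
    nlinarith
  · exact (h2 N h).trans (sub_le_self _ (by positivity))

/-- **Hilbert's inequality** with the constant `4`. -/
lemma tsum_mul_div_add_le (b : ℕ → ℝ) :
    ∑' j : ℕ, ∑' k : ℕ, ENNReal.ofReal (b j * b k / (j + k + 1)) ≤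
      4 * ∑' k, ENNReal.ofReal (b k ^ 2) := by
  -- Schur's test: with s = √(j+1) and t = √(k+1), the inequality 2 b_j b_k ≤ (s/t) b_j² + (t/s)
  -- b_k² bounds each term by `T j k + T k j`. Row j of T sums to at most 2 b_j², and the two
  -- symmetric halves give the constant 4.
  let T : ℕ → ℕ → ℝ≥0∞ := fun j k =>
    ENNReal.ofReal (b j ^ 2 / 2 * √(j + 1 : ℝ)) *
      ENNReal.ofReal (1 / (√(k + 1 : ℝ) * (j + k + 1)))
  have hT : ∑' j, ∑' k, T j k ≤ 2 * ∑' k, ENNReal.ofReal (b k ^ 2) := by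
    rw [← ENNReal.tsum_mul_left]
    refine ENNReal.tsum_le_tsum fun j => ?_
    rw [ENNReal.tsum_mul_left]
    have h4 : ∑' k : ℕ, ENNReal.ofReal (1 / (√(k + 1 : ℝ) * (j + k + 1))) ≤
        ENNReal.ofReal (4 / √(j + 1 : ℝ)) := ENNReal.tsum_le_of_sum_range_le fun N => by
      rw [← ENNReal.ofReal_sum_of_nonneg fun k _ => by positivity]
      exact ENNReal.ofReal_le_ofReal (sum_inv_sqrt_mul_inv_add_le j N)
    refine (mul_le_mul_right h4 _).trans_eq ?_
    rw [← ENNReal.ofReal_mul (by positivity), ← ENNReal.ofReal_ofNat 2,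
      ← ENNReal.ofReal_mul zero_le_two]
    congr 1
    have : 0 < √(j + 1 : ℝ) := by positivity
    field_simp
    norm_num
  calc _ ≤ ∑' j, ∑' k, (T j k + T k j) := by
        refine ENNReal.tsum_le_tsum fun j => ENNReal.tsum_le_tsum fun k => ?_
        simp only [T]
        rw [← ENNReal.ofReal_mul (by positivity), ← ENNReal.ofReal_mul (by positivity),
          ← ENNReal.ofReal_add (by positivity) (by positivity)]
        refine ENNReal.ofReal_le_ofReal ?_
        have hj : 0 < √(j + 1 : ℝ) := by positivity
        have hk : 0 < √(k + 1 : ℝ) := by positivity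
        generalize √(j + 1 : ℝ) = s at *
        generalize √(k + 1 : ℝ) = t at *
        have hd : (0 : ℝ) < j + k + 1 := by positivity
        have e : b j ^ 2 / 2 * s * (1 / (t * (j + k + 1))) + b k ^ 2 / 2 * t *
            (1 / (s * (k + j + 1))) = ((b j * s) ^ 2 + (b k * t) ^ 2) / (2 * (s * t)) /
              (j + k + 1) := by
          rw [show (k + j + 1 : ℝ) = j + k + 1 by ring]
          field_simp
        rw [e]
        gcongr
        rw [le_div_iff₀ (by positivity)]
        nlinarith [sq_nonneg (b j * s - b k * t)]
    _ = ∑' j, ∑' k, T j k + ∑' j, ∑' k, T j k := by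
        simp only [ENNReal.tsum_add]
        congr 1
        exact ENNReal.tsum_comm
    _ ≤ _ := by
        refine (add_le_add hT hT).trans_eq ?_
        rw [← add_mul]; norm_num

/-- Expanding the square produces the moments 1/(j+k+2) ≤ 1/(j+k+1), to which Hilbert's inequality
applies. -/
lemma lintegral_sq_tsum_pow_le {b : ℕ → ℝ} (hb : ∀ k, 0 ≤ b k) :
    ∫⁻ ρ in Set.Ioo (0 : ℝ) 1, ENNReal.ofReal ρ * (∑' k, ENNReal.ofReal (b k * ρ ^ k)) ^ 2 ≤
      4 * ∑' k, ENNReal.ofReal (b k ^ 2) := by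
  have hswap : ∫⁻ ρ in Set.Ioo (0 : ℝ) 1,
      ENNReal.ofReal ρ * (∑' k, ENNReal.ofReal (b k * ρ ^ k)) ^ 2 =
      ∑' j, ∑' k, ENNReal.ofReal (b j * b k / 2) * ∫⁻ ρ in Set.Ioo (0 : ℝ) 1,
        ENNReal.ofReal (2 * ρ ^ (j + k + 1)) := by
    calc _ = ∫⁻ ρ in Set.Ioo (0 : ℝ) 1, ∑' j, ∑' k, ENNReal.ofReal (b j * b k / 2) *
          ENNReal.ofReal (2 * ρ ^ (j + k + 1)) := by
          refine setLIntegral_congr_fun measurableSet_Ioo fun ρ hρ => ?_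
          have h0 := hρ.1.le
          rw [sq, ← ENNReal.tsum_mul_right, ← ENNReal.tsum_mul_left]
          refine tsum_congr fun j => ?_
          rw [← ENNReal.tsum_mul_left, ← ENNReal.tsum_mul_left]
          refine tsum_congr fun k => ?_
          have := hb j
          have := hb k
          rw [← ENNReal.ofReal_mul (by positivity), ← ENNReal.ofReal_mul (by positivity),
            ← ENNReal.ofReal_mul (by positivity)]
          congr 1
          ring
      _ = _ := by
          rw [lintegral_tsum fun j => by fun_prop]
          refine tsum_congr fun j => ?_
          rw [lintegral_tsum fun k => by fun_prop]
          refine tsum_congr fun k => ?_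
          rw [lintegral_const_mul _ (by fun_prop)]
  refine hswap.trans_le ((ENNReal.tsum_le_tsum fun j => ENNReal.tsum_le_tsum
    fun k => ?_).trans (tsum_mul_div_add_le b))
  · have := hb j
    have := hb k
    have hI : ∫⁻ ρ in Set.Ioo (0 : ℝ) 1, ENNReal.ofReal (2 * ρ ^ (j + k + 1)) =
        ENNReal.ofReal (2 / (j + k + 2)) := by
      rw [← ofReal_integral_eq_lintegral_ofReal, ← integral_Ioc_eq_integral_Ioo,
        ← intervalIntegral.integral_of_le zero_le_one, intervalIntegral.integral_const_mul,
        integral_pow]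
      · congr 1
        push_cast
        simp
        ring
      · exact (Continuous.integrableOn_Icc (by fun_prop)).mono_set Set.Ioo_subset_Icc_self
      · refine (ae_restrict_iff' measurableSet_Ioo).2 (Eventually.of_forall fun ρ hρ => ?_)
        have h0 := hρ.1.le
        simp only [Pi.zero_apply]
        positivity
    rw [hI, ← ENNReal.ofReal_mul (by positivity)]
    refine ENNReal.ofReal_le_ofReal ?_
    rw [div_mul_div_cancel₀ two_ne_zero]
    gcongr
    norm_num

/-! ### The Poisson extension of a measure -/

section Poisson

variable {z : ℂ} (ζ : sphere (0 : ℂ) 1)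

lemma one_sub_norm_le_norm_sub : 1 - ‖z‖ ≤ ‖(ζ : ℂ) - z‖ := by
  simpa using norm_sub_norm_le (ζ : ℂ) z

lemma one_sub_norm_sq_pos (hz : ‖z‖ < 1) : 0 < 1 - ‖z‖ ^ 2 := by
  nlinarith [norm_nonneg z]

lemma poisson_kernel_nonneg (hz : ‖z‖ < 1) : 0 ≤ (1 - ‖z‖ ^ 2) / ‖(ζ : ℂ) - z‖ ^ 2 := by
  have := one_sub_norm_sq_pos hz
  positivity

/-- Two points of the closed disc are at distance at most 2. -/
lemma le_poisson_kernel (hz : ‖z‖ < 1) :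
    (1 - ‖z‖ ^ 2) / 4 ≤ (1 - ‖z‖ ^ 2) / ‖(ζ : ℂ) - z‖ ^ 2 := by
  have h := one_sub_norm_sq_pos hz
  have h1 := one_sub_norm_le_norm_sub (z := z) ζ
  have h2 : ‖(ζ : ℂ) - z‖ ≤ 2 := (norm_sub_le _ _).trans (by simp; linarith)
  have h3 : 0 < ‖(ζ : ℂ) - z‖ := by linarith
  gcongr
  nlinarith

/-- Here |ζ - z| ≥ 1 - |z| ≥ (1 - |z|²)/2. -/
lemma poisson_kernel_le (hz : ‖z‖ < 1) :
    (1 - ‖z‖ ^ 2) / ‖(ζ : ℂ) - z‖ ^ 2 ≤ 4 / (1 - ‖z‖ ^ 2) := by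
  have h := one_sub_norm_sq_pos hz
  have h1 := one_sub_norm_le_norm_sub (z := z) ζ
  have h3 : 0 < ‖(ζ : ℂ) - z‖ := by linarith
  have h4 : 1 - ‖z‖ ^ 2 ≤ 2 * ‖(ζ : ℂ) - z‖ := by nlinarith [norm_nonneg z]
  rw [div_le_div_iff₀ (by positivity) h]
  nlinarith

lemma measurable_poisson_kernel : Measurable fun p : ℂ × sphere (0 : ℂ) 1 =>
    (1 - ‖p.1‖ ^ 2) / ‖(p.2 : ℂ) - p.1‖ ^ 2 := by
  fun_prop

lemma poisson_kernel_eq_re {w : ℂ} : (1 - ‖w‖ ^ 2) / ‖(ζ : ℂ) - w‖ ^ 2 =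
    (((ζ : ℂ) + w) / (ζ - w)).re := by
  have h := congrFun (poissonKernel_eq_re_herglotzRieszKernel (c := 0) (w := w)) ζ
  simpa [poissonKernel_def, herglotzRieszKernel_def] using h

lemma continuousOn_poisson_kernel :
    ContinuousOn (fun w : ℂ => (1 - ‖w‖ ^ 2) / ‖(ζ : ℂ) - w‖ ^ 2) (ball 0 1) := by
  refine ContinuousOn.div (by fun_prop) (by fun_prop) fun w hw => ?_
  have := one_sub_norm_le_norm_sub (z := w) ζ
  have hw' : ‖w‖ < 1 := by simpa using hw
  have : 0 < ‖(ζ : ℂ) - w‖ := by linarith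
  positivity

/-- The kernel is the real part of the function (ζ + w)/(ζ - w), holomorphic in w on the disc, so
the mean value property gives its value 1 at w = 0. -/
lemma circleAverage_poisson_kernel {ρ : ℝ} (h0 : 0 ≤ ρ) (h1 : ρ < 1) :
    Real.circleAverage (fun w : ℂ => (1 - ‖w‖ ^ 2) / ‖(ζ : ℂ) - w‖ ^ 2) 0 ρ = 1 := by
  have hne : ∀ w ∈ ball (0 : ℂ) 1, (ζ : ℂ) - w ≠ 0 := fun w hw => by
    have := one_sub_norm_le_norm_sub (z := w) ζ
    have hw' : ‖w‖ < 1 := by simpa using hw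
    exact norm_pos_iff.1 (by linarith)
  have hd : DifferentiableOn ℂ (fun w : ℂ => ((ζ : ℂ) + w) / (ζ - w)) (ball 0 1) :=
    DifferentiableOn.div (by fun_prop) (by fun_prop) hne
  have hsub : closedBall (0 : ℂ) |ρ| ⊆ ball 0 1 :=
    closedBall_subset_ball (by rwa [abs_of_nonneg h0])
  have hdc : DiffContOnCl ℂ (fun w : ℂ => ((ζ : ℂ) + w) / (ζ - w)) (ball 0 |ρ|) :=
    (hd.mono (closure_ball_subset_closedBall.trans hsub)).diffContOnCl
  have hci : CircleIntegrable (fun w : ℂ => ((ζ : ℂ) + w) / (ζ - w)) 0 ρ :=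
    (hd.continuousOn.mono (sphere_subset_closedBall.trans hsub)).circleIntegrable'
  have h := Complex.reCLM.circleAverage_comp_comm hci
  rw [hdc.circleAverage] at h
  simp only [poisson_kernel_eq_re]
  refine h.trans ?_
  have : (ζ : ℂ) ≠ 0 := by simpa using hne 0 (by simp)
  simp [this]

lemma lintegral_circle_poisson_kernel {ρ : ℝ} (h0 : 0 ≤ ρ) (h1 : ρ < 1) :
    ∫⁻ θ in Set.Ioo (-Real.pi) Real.pi, ENNReal.ofReal ((1 - ‖circleMap 0 ρ θ‖ ^ 2) /
      ‖(ζ : ℂ) - circleMap 0 ρ θ‖ ^ 2) = ENNReal.ofReal (2 * Real.pi) := by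
  have hsub : sphere (0 : ℂ) |ρ| ⊆ ball 0 1 :=
    sphere_subset_closedBall.trans (closedBall_subset_ball (by rwa [abs_of_nonneg h0]))
  rw [lintegral_circle (F := fun w : ℂ => (1 - ‖w‖ ^ 2) / ‖(ζ : ℂ) - w‖ ^ 2)
    ((continuousOn_poisson_kernel ζ).mono hsub)
    (fun w hw => poisson_kernel_nonneg ζ (by simpa using hsub hw)),
    circleAverage_poisson_kernel ζ h0 h1, ENNReal.ofReal_one, mul_one]

lemma poissonExt_nonneg (μ : Measure (sphere (0 : ℂ) 1)) (hz : ‖z‖ < 1) : 0 ≤ poissonExt μ z :=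
  integral_nonneg fun ζ => poisson_kernel_nonneg ζ hz

variable (μ : Measure (sphere (0 : ℂ) 1)) [IsFiniteMeasure μ]

lemma integrable_poisson_kernel (hz : ‖z‖ < 1) :
    Integrable (fun ζ : sphere (0 : ℂ) 1 => (1 - ‖z‖ ^ 2) / ‖(ζ : ℂ) - z‖ ^ 2) μ := by
  refine Integrable.of_bound (Measurable.aestronglyMeasurable (by fun_prop))
    (4 / (1 - ‖z‖ ^ 2)) (Eventually.of_forall fun ζ => ?_)
  rw [Real.norm_of_nonneg (poisson_kernel_nonneg ζ hz)]
  exact poisson_kernel_le ζ hz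

lemma measurable_poissonExt : Measurable (poissonExt μ) :=
  (measurable_poisson_kernel.stronglyMeasurable.integral_prod_right').measurable

lemma poissonExt_le (hz : ‖z‖ < 1) : poissonExt μ z ≤ 4 * μ.real Set.univ / (1 - ‖z‖ ^ 2) := by
  refine (integral_mono (integrable_poisson_kernel μ hz) (integrable_const _)
    fun ζ => poisson_kernel_le ζ hz).trans_eq ?_
  simp
  ring

lemma le_poissonExt (hz : ‖z‖ < 1) : μ.real Set.univ / 4 * (1 - ‖z‖ ^ 2) ≤ poissonExt μ z := by
  refine le_trans (le_of_eq ?_) (integral_mono (integrable_const _)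
    (integrable_poisson_kernel μ hz) fun ζ => le_poisson_kernel ζ hz)
  simp
  ring

lemma ofReal_poissonExt (hz : ‖z‖ < 1) : ENNReal.ofReal (poissonExt μ z) =
    ∫⁻ ζ : sphere (0 : ℂ) 1, ENNReal.ofReal ((1 - ‖z‖ ^ 2) / ‖(ζ : ℂ) - z‖ ^ 2) ∂μ :=
  ofReal_integral_eq_lintegral_ofReal (integrable_poisson_kernel μ hz)
    (Eventually.of_forall fun ζ => poisson_kernel_nonneg ζ hz)

/-- By Tonelli, the mean of P_μ over a circle is the μ-integral of the kernel means, all equal to 1.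
That it does not depend on ρ is what replaces the pointwise bound 4μ(𝕋)/(1 - |z|²) when that bound
is too weak. -/
lemma lintegral_circle_poissonExt {ρ : ℝ} (h0 : 0 ≤ ρ) (h1 : ρ < 1) :
    ∫⁻ θ in Set.Ioo (-Real.pi) Real.pi, ENNReal.ofReal (poissonExt μ (circleMap 0 ρ θ)) =
      ENNReal.ofReal (2 * Real.pi) * μ Set.univ := by
  have hn : ∀ θ, ‖circleMap 0 ρ θ‖ < 1 := fun θ => by simpa [abs_of_nonneg h0] using h1
  simp only [fun θ => ofReal_poissonExt μ (hn θ)]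
  rw [lintegral_lintegral_swap]
  · simp only [fun ζ => lintegral_circle_poisson_kernel ζ h0 h1, lintegral_const]
  · refine Measurable.aemeasurable ?_
    have : Measurable fun p : ℝ × sphere (0 : ℂ) 1 => (circleMap 0 ρ p.1, p.2) := by
      fun_prop
    exact (measurable_poisson_kernel.comp this).ennreal_ofReal

/-- The measure `P_μ dA` is a Carleson measure for the Hardy space `H²`. -/
lemma lintegral_norm_sq_mul_poissonExt_le {g : ℂ → ℂ} (hg : DifferentiableOn ℂ g (ball 0 1)) :
    ∫⁻ z in ball (0 : ℂ) 1, ENNReal.ofReal (‖g z‖ ^ 2) * ENNReal.ofReal (poissonExt μ z) ≤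
      ENNReal.ofReal (2 * Real.pi) * μ Set.univ *
        (4 * ∑' k, ENNReal.ofReal (‖taylorCoeff g k‖ ^ 2)) := by
  have hgm := measurable_indicator_ball hg
  have hP := measurable_poissonExt μ
  calc _ = ∫⁻ z in ball (0 : ℂ) 1,
          ENNReal.ofReal (‖(ball (0 : ℂ) 1).indicator g z‖ ^ 2) *
            ENNReal.ofReal (poissonExt μ z) :=
        setLIntegral_congr_fun measurableSet_ball fun z hz => by
          simp only [Set.indicator_of_mem hz]
    _ ≤ ∫⁻ ρ in Set.Ioo (0 : ℝ) 1, ENNReal.ofReal (2 * Real.pi) * μ Set.univ *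
          (ENNReal.ofReal ρ * (∑' k, ENNReal.ofReal (‖taylorCoeff g k‖ * ρ ^ k)) ^ 2) := by
        rw [lintegral_unitDisc _ (by fun_prop)]
        refine setLIntegral_mono' measurableSet_Ioo fun ρ hρ => ?_
        obtain ⟨h0, h1⟩ := hρ
        have hsum := summable_norm_taylorCoeff hg h0.le h1
        -- The majorant does not depend on θ, so it leaves the circle integral and only the mean of
        -- P_μ remains.
        have hpt : ∀ θ, ENNReal.ofReal (‖(ball (0 : ℂ) 1).indicator g (circleMap 0 ρ θ)‖ ^ 2) ≤
            (∑' k, ENNReal.ofReal (‖taylorCoeff g k‖ * ρ ^ k)) ^ 2 := fun θ => by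
          have hn : ‖circleMap 0 ρ θ‖ < 1 := by simpa [abs_of_pos h0] using h1
          rw [Set.indicator_of_mem (by simpa using hn), ENNReal.ofReal_pow (norm_nonneg _),
            ← ENNReal.ofReal_tsum_of_nonneg (fun k => by positivity) hsum]
          gcongr
          rw [← (hasSum_taylorCoeff hg hn).tsum_eq]
          refine tsum_of_norm_bounded hsum.hasSum fun k => ?_
          simp [abs_of_pos h0]
        calc _ ≤ ENNReal.ofReal ρ * ∫⁻ θ in Set.Ioo (-Real.pi) Real.pi,
              (∑' k, ENNReal.ofReal (‖taylorCoeff g k‖ * ρ ^ k)) ^ 2 *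
                ENNReal.ofReal (poissonExt μ (circleMap 0 ρ θ)) := by
              gcongr with θ
              exact hpt θ
          _ = _ := by
              rw [lintegral_const_mul _ (by fun_prop), lintegral_circle_poissonExt μ h0.le h1]
              ring
    _ ≤ _ := by
        rw [lintegral_const_mul _ (by fun_prop)]
        gcongr
        exact lintegral_sq_tsum_pow_le fun k => norm_nonneg _

lemma lintegral_poissonExt :
    ∫⁻ z in ball (0 : ℂ) 1, ENNReal.ofReal (poissonExt μ z) =
      ENNReal.ofReal Real.pi * μ Set.univ := by
  have hP := measurable_poissonExt μ
  rw [lintegral_unitDisc _ (by fun_prop)]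
  -- The radial integrand is written as the moment with j = m = 0, whose value is 1.
  calc _ = ∫⁻ ρ in Set.Ioo (0 : ℝ) 1, ENNReal.ofReal Real.pi * μ Set.univ *
        (ENNReal.ofReal (2 * ρ ^ (2 * 0 + 1)) * ENNReal.ofReal ((1 - ρ ^ 2) ^ 0)) :=
        setLIntegral_congr_fun measurableSet_Ioo fun ρ hρ => by
          rw [lintegral_circle_poissonExt μ hρ.1.le hρ.2]
          simp [ENNReal.ofReal_mul zero_le_two]
          ring
    _ = _ := by
        rw [lintegral_const_mul _ (by fun_prop), lintegral_pow_mul_one_sub_sq_pow]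
        simp

end Poisson

/-! ### Normalized arc length -/

instance : IsFiniteMeasure normArcLength :=
  Measure.smul_finite _ ENNReal.ofReal_ne_top

/-- Poisson's formula for the constant harmonic function 1. -/
lemma poissonExt_normArcLength {z : ℂ} (hz : ‖z‖ < 1) : poissonExt normArcLength z = 1 := by
  have hc : Continuous fun θ : ℝ =>
      (⟨exp (θ * I), by simp [norm_exp_ofReal_mul_I]⟩ : sphere (0 : ℂ) 1) := by fun_prop
  have h := InnerProductSpace.HarmonicOnNhd.circleAverage_poissonKernel_smul
    (f := fun _ : ℂ => (1 : ℝ)) (c := 0) (R := 1) (w := z) (fun x _ => InnerProductSpace.harmonicAt_const 1) (by simpa using hz)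
  rw [poissonExt, normArcLength, integral_smul_measure, integral_map hc.aemeasurable
    (Measurable.aestronglyMeasurable (by fun_prop)), ← intervalIntegral.integral_of_le
    (by linarith [Real.pi_pos])]
  refine Eq.trans ?_ h
  rw [Real.circleAverage_eq_integral_add (-Real.pi),
    intervalIntegral.integral_comp_add_right (fun θ => (poissonKernel 0 z •
      fun _ : ℂ => (1 : ℝ)) (circleMap 0 1 θ)), zero_add,
    show 2 * Real.pi + -Real.pi = Real.pi by ring,
    ENNReal.toReal_ofReal (by positivity), one_div]
  simp [poissonKernel_def, circleMap]

/-! ### Functions smooth on the closed disc -/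

section Smooth

variable {f : ℂ → ℂ}

/-- On the boundary circle `deriv f` depends on the arbitrary values of f outside the disc. The real
derivative within the closed disc, in direction 1, is smooth up to the boundary and agrees with f'
inside; it serves as the smooth representative. -/
lemma SmoothAnalytic.exists_eqOn_deriv (hf : SmoothAnalytic f) :
    ∃ g, SmoothAnalytic g ∧ Set.EqOn g (deriv f) (ball 0 1) := by
  have heq : Set.EqOn (fun z => fderivWithin ℝ f (closedBall 0 1) z 1) (deriv f) (ball 0 1) := by
    intro z hz
    have hd := (hf.1.differentiableAt (isOpen_ball.mem_nhds hz)).hasDerivAt.complexToReal_fderiv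
    simp only
    rw [fderivWithin_of_mem_nhds (Filter.mem_of_superset (isOpen_ball.mem_nhds hz)
      ball_subset_closedBall), hd.fderiv]
    simp
  refine ⟨_, ⟨(hf.1.deriv isOpen_ball).congr heq, ?_⟩, heq⟩
  have huniq : UniqueDiffOn ℝ (closedBall (0 : ℂ) 1) :=
    uniqueDiffOn_convex (convex_closedBall 0 1)
      ⟨0, ball_subset_interior_closedBall (mem_ball_self one_pos)⟩
  exact (hf.2.fderivWithin (m := ∞) huniq (by simp)).clm_apply contDiffOn_const

lemma SmoothAnalytic.exists_eqOn_iteratedDeriv (hf : SmoothAnalytic f) (n : ℕ) :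
    ∃ g, SmoothAnalytic g ∧ Set.EqOn g (iteratedDeriv n f) (ball 0 1) := by
  induction n with
  | zero => exact ⟨f, hf, fun z _ => by simp⟩
  | succ n ih =>
    obtain ⟨g, hg, hgf⟩ := ih
    obtain ⟨h, hh, hhg⟩ := hg.exists_eqOn_deriv
    refine ⟨h, hh, fun z hz => ?_⟩
    rw [hhg hz, iteratedDeriv_succ]
    exact (hgf.eventuallyEq_of_mem (isOpen_ball.mem_nhds hz)).deriv_eq

lemma SmoothAnalytic.differentiableOn_iteratedDeriv (hf : SmoothAnalytic f) (n : ℕ) :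
    DifferentiableOn ℂ (iteratedDeriv n f) (ball 0 1) := by
  obtain ⟨g, hg, hgf⟩ := hf.exists_eqOn_iteratedDeriv n
  exact hg.1.congr hgf.symm

lemma SmoothAnalytic.exists_norm_iteratedDeriv_le (hf : SmoothAnalytic f) (n : ℕ) :
    ∃ M, ∀ z ∈ ball (0 : ℂ) 1, ‖iteratedDeriv n f z‖ ≤ M := by
  obtain ⟨g, hg, hgf⟩ := hf.exists_eqOn_iteratedDeriv n
  obtain ⟨M, hM⟩ := (isCompact_closedBall (0 : ℂ) 1).exists_bound_of_continuousOn hg.2.continuousOn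
  exact ⟨M, fun z hz => hgf hz ▸ hM z (ball_subset_closedBall hz)⟩

lemma taylorCoeff_iteratedDeriv (f : ℂ → ℂ) (n k : ℕ) :
    taylorCoeff (iteratedDeriv n f) k = ((k + n)! / k ! : ℂ) * taylorCoeff f (k + n) := by
  have h : iteratedDeriv k (iteratedDeriv n f) = iteratedDeriv (k + n) f := by
    simp only [iteratedDeriv_eq_iterate, Function.iterate_add_apply]
  have := Nat.factorial_ne_zero (k + n)
  have := Nat.factorial_ne_zero k
  rw [taylorCoeff, taylorCoeff, h]
  field_simp

lemma norm_taylorCoeff_iteratedDeriv_sq (f : ℂ → ℂ) (n k : ℕ) :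
    ‖taylorCoeff (iteratedDeriv n f) k‖ ^ 2 =
      ((k + n)! / k ! : ℝ) ^ 2 * ‖taylorCoeff f (k + n)‖ ^ 2 := by
  rw [taylorCoeff_iteratedDeriv, norm_mul, mul_pow]
  simp

/-- Continuity up to the boundary permits Cauchy's formula on the unit circle itself, where the
conjugate of ζ is 1/ζ. -/
lemma SmoothAnalytic.circleCoeff_eq (hf : SmoothAnalytic f) (k : ℕ) :
    circleCoeff f k = taylorCoeff f k := by
  have hd : DiffContOnCl ℂ f (ball 0 ((1 : NNReal) : ℝ)) :=
    ⟨by simpa using hf.1, by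
      rw [closure_ball _ (by simp)]; simpa using hf.2.continuousOn⟩
  have h := (hd.hasFPowerSeriesOnBall one_pos).factorial_smul 1 k
  rw [cauchyPowerSeries_apply] at h
  rw [circleCoeff, taylorCoeff, iteratedDeriv_eq_iteratedFDeriv, ← h, nsmul_eq_mul,
    inv_mul_cancel_left₀ (by exact_mod_cast Nat.factorial_ne_zero k)]
  rw [Real.circleAverage_congr_sphere (f₂ := fun z => (1 / (z - 0)) ^ k • f z),
    Real.circleAverage_eq_circleIntegral one_ne_zero]
  · congr 1
    refine circleIntegral.integral_congr (by simp) fun z _ => ?_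
    simp only [smul_eq_mul]
    ring
  · intro z hz
    have hz1 : ‖z‖ = 1 := by simpa using hz
    simp only [sub_zero, one_div, smul_eq_mul, Complex.inv_def, normSq_eq_norm_sq, hz1]
    simp [mul_comm]

end Smooth

/-! ### Existence of the weighted Dirichlet integrals -/

section Dirichlet

variable {f : ℂ → ℂ} (μ : Measure (sphere (0 : ℂ) 1))

lemma dirichlet_integrand_nonneg (n m : ℕ) {z : ℂ} (hz : z ∈ ball (0 : ℂ) 1) :
    0 ≤ ‖iteratedDeriv n f z‖ ^ 2 * poissonExt μ z * (1 - ‖z‖ ^ 2) ^ m := by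
  have hz1 : ‖z‖ < 1 := by simpa using hz
  have hP0 := poissonExt_nonneg μ hz1
  have h1 := one_sub_norm_sq_pos hz1
  positivity

variable [IsFiniteMeasure μ]

/-- The derivative is bounded, P_μ is integrable over the disc and the power of 1 - |z|² is at most
1. Finiteness and existence of the limits of order at least 1 rest on this. -/
lemma SmoothAnalytic.integrableOn_dirichlet (hf : SmoothAnalytic f) (n m : ℕ) :
    IntegrableOn (fun z => ‖iteratedDeriv n f z‖ ^ 2 * poissonExt μ z * (1 - ‖z‖ ^ 2) ^ m)
      (ball 0 1) := by
  obtain ⟨M, hM⟩ := hf.exists_norm_iteratedDeriv_le n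
  have hP := measurable_poissonExt μ
  have hPi : IntegrableOn (poissonExt μ) (ball (0 : ℂ) 1) := by
    refine ⟨hP.aestronglyMeasurable, ?_⟩
    rw [hasFiniteIntegral_iff_ofReal ((ae_restrict_iff' measurableSet_ball).2
      (Eventually.of_forall fun z hz => poissonExt_nonneg μ (by simpa using hz))),
      lintegral_poissonExt]
    exact ENNReal.mul_lt_top ENNReal.ofReal_lt_top (measure_lt_top _ _)
  refine (hPi.const_mul (M ^ 2)).mono' ?_ ((ae_restrict_iff' measurableSet_ball).2
      (Eventually.of_forall fun z hz => ?_))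
  · have h1 : AEStronglyMeasurable (iteratedDeriv n f) (volume.restrict (ball (0 : ℂ) 1)) :=
      (hf.differentiableOn_iteratedDeriv n).continuousOn.aestronglyMeasurable measurableSet_ball
    exact ((h1.norm.pow 2).mul hP.aestronglyMeasurable).mul
      (Continuous.aestronglyMeasurable (by fun_prop))
  · have hz1 : ‖z‖ < 1 := by simpa using hz
    have hP0 := poissonExt_nonneg μ hz1
    have h1 := one_sub_norm_sq_pos hz1
    have hM0 : ‖iteratedDeriv n f z‖ ≤ M := hM z hz
    rw [Real.norm_of_nonneg (by positivity)]
    have h2 : (1 - ‖z‖ ^ 2) ^ m ≤ 1 := pow_le_one₀ h1.le (by nlinarith [norm_nonneg z])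
    calc _ ≤ ‖iteratedDeriv n f z‖ ^ 2 * poissonExt μ z * 1 := by gcongr
      _ ≤ _ := by rw [mul_one]; gcongr

lemma tendsto_setIntegral_ball {F : ℂ → ℝ} (hF : IntegrableOn F (ball 0 1)) :
    Tendsto (fun r : ℝ => ∫ z in ball 0 r, F z) (𝓝[<] 1) (𝓝 (∫ z in ball 0 1, F z)) := by
  have hc : AECover (volume.restrict (ball (0 : ℂ) 1)) (𝓝[<] (1 : ℝ)) fun r => ball 0 r := by
    refine ⟨(ae_restrict_iff' measurableSet_ball).2 (Eventually.of_forall fun z hz => ?_),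
      fun r => measurableSet_ball⟩
    have hz1 : ‖z‖ < 1 := by simpa using hz
    filter_upwards [nhdsWithin_le_nhds (Ioi_mem_nhds hz1)] with r hr
    simpa using hr
  refine (hc.integral_tendsto_of_countably_generated hF).congr' ?_
  filter_upwards [self_mem_nhdsWithin] with r hr
  rw [Measure.restrict_restrict measurableSet_ball,
    Set.inter_eq_left.2 (ball_subset_ball (le_of_lt hr))]

lemma SmoothAnalytic.tendsto_dirichletTrunc (hf : SmoothAnalytic f) (m : ℕ) :
    Tendsto (dirichletTrunc μ (m + 1) f) (𝓝[<] 1) (𝓝 (1 / ((m + 1)! * m ! * Real.pi) *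
      ∫ z in ball (0 : ℂ) 1,
        ‖iteratedDeriv (m + 1) f z‖ ^ 2 * poissonExt μ z * (1 - ‖z‖ ^ 2) ^ m)) :=
  (tendsto_setIntegral_ball (hf.integrableOn_dirichlet μ (m + 1) m)).const_mul _

lemma SmoothAnalytic.dirichletInt_eq (hf : SmoothAnalytic f) (m : ℕ) :
    dirichletInt μ (m + 1) f = 1 / ((m + 1)! * m ! * Real.pi) *
      ∫ z in ball (0 : ℂ) 1,
        ‖iteratedDeriv (m + 1) f z‖ ^ 2 * poissonExt μ z * (1 - ‖z‖ ^ 2) ^ m :=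
  (hf.tendsto_dirichletTrunc μ m).limUnder_eq

lemma SmoothAnalytic.dirichletInt_nonneg (hf : SmoothAnalytic f) (m : ℕ) :
    0 ≤ dirichletInt μ (m + 1) f := by
  rw [hf.dirichletInt_eq μ]
  exact mul_nonneg (by positivity) (setIntegral_nonneg measurableSet_ball
    fun z hz => dirichlet_integrand_nonneg μ _ _ hz)

lemma SmoothAnalytic.ofReal_dirichletInt (hf : SmoothAnalytic f) (m : ℕ) :
    ENNReal.ofReal (dirichletInt μ (m + 1) f) = ENNReal.ofReal (1 / ((m + 1)! * m ! * Real.pi)) *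
      ∫⁻ z in ball (0 : ℂ) 1, ENNReal.ofReal (‖iteratedDeriv (m + 1) f z‖ ^ 2) *
        ENNReal.ofReal (poissonExt μ z * (1 - ‖z‖ ^ 2) ^ m) := by
  rw [hf.dirichletInt_eq μ, ENNReal.ofReal_mul (by positivity), ofReal_integral_eq_lintegral_ofReal
    (hf.integrableOn_dirichlet μ _ _) ((ae_restrict_iff' measurableSet_ball).2
      (Eventually.of_forall fun z hz => dirichlet_integrand_nonneg μ _ _ hz))]
  congr 1
  refine setLIntegral_congr_fun measurableSet_ball fun z hz => ?_
  rw [← ENNReal.ofReal_mul (by positivity), mul_assoc]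

lemma dirichletTrunc_normArcLength_zero {r : ℝ} (h0 : 0 ≤ r) (h1 : r < 1) :
    dirichletTrunc normArcLength 0 f r = Real.circleAverage (fun z => ‖f z‖ ^ 2) 0 r := by
  change Real.circleAverage (fun z => ‖f z‖ ^ 2 * poissonExt normArcLength z) 0 r = _
  refine Real.circleAverage_congr_sphere fun z hz => ?_
  rw [mem_sphere_zero_iff_norm, abs_of_nonneg h0] at hz
  rw [poissonExt_normArcLength (hz.trans_lt h1), mul_one]

/-- With P_λ = 1 only circle means of |f|² remain, and these are continuous in the radius up to 1.
-/
lemma SmoothAnalytic.tendsto_dirichletTrunc_zero (hf : SmoothAnalytic f) :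
    Tendsto (dirichletTrunc normArcLength 0 f) (𝓝[<] 1)
      (𝓝 (Real.circleAverage (fun z => ‖f z‖ ^ 2) 0 1)) := by
  have hc : ContinuousOn (Real.circleAverage (fun z => ‖f z‖ ^ 2) 0) (Set.Icc 0 1) := by
    refine Real.ContinuousOn.circleAverage (f := fun z => ‖f z‖ ^ 2)
      (ContinuousOn.pow (hf.2.continuousOn.mono ?_).norm 2) fun r hr => hr.1
    intro z hz
    simpa using hz.2
  have h := (hc 1 (by simp)).mono_left (nhdsWithin_mono _ Set.Ico_subset_Icc_self)
  rw [nhdsWithin_Ico_eq_nhdsLT one_pos] at h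
  refine h.congr' ?_
  filter_upwards [Ioo_mem_nhdsLT one_pos] with r hr
  exact (dirichletTrunc_normArcLength_zero hr.1.le hr.2).symm

end Dirichlet

/-! ### Comparison of the weighted Dirichlet integrals -/

/-- The weight `(k + n choose n)` of the `(k + n)`-th coefficient in `D_{λ,n}`. -/
noncomputable def dirichletWeight (n k : ℕ) : ℝ := (k + n)! / (k ! * n !)

lemma dirichletWeight_zero_right (n : ℕ) : dirichletWeight n 0 = 1 := by
  have := Nat.factorial_ne_zero n
  simp [dirichletWeight, this]

lemma dirichletWeight_nonneg (n k : ℕ) : 0 ≤ dirichletWeight n k := by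
  unfold dirichletWeight; positivity

section

variable {f : ℂ → ℂ}

/-- With n = m+1, differentiation contributes ((k+n)!/k!)², the moment contributes k! m!/(k+n)!, and
the normalizing constant leaves exactly binom(k+n, n). -/
lemma SmoothAnalytic.ofReal_dirichletInt_normArcLength_succ (hf : SmoothAnalytic f) (m : ℕ) :
    ENNReal.ofReal (dirichletInt normArcLength (m + 1) f) =
      ∑' k, ENNReal.ofReal (dirichletWeight (m + 1) k * ‖taylorCoeff f (k + (m + 1))‖ ^ 2) := by
  rw [hf.ofReal_dirichletInt normArcLength]
  have h : ∫⁻ z in ball (0 : ℂ) 1, ENNReal.ofReal (‖iteratedDeriv (m + 1) f z‖ ^ 2) *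
      ENNReal.ofReal (poissonExt normArcLength z * (1 - ‖z‖ ^ 2) ^ m) =
      ∫⁻ z in ball (0 : ℂ) 1, ENNReal.ofReal (‖iteratedDeriv (m + 1) f z‖ ^ 2) *
      ENNReal.ofReal ((1 - ‖z‖ ^ 2) ^ m) :=
    setLIntegral_congr_fun measurableSet_ball fun z hz => by
      rw [poissonExt_normArcLength (by simpa using hz), one_mul]
  rw [h, lintegral_norm_sq_mul_one_sub_sq_pow (hf.differentiableOn_iteratedDeriv _), ← mul_assoc,
    ← ENNReal.ofReal_mul (by positivity), ← ENNReal.tsum_mul_left]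
  refine tsum_congr fun k => ?_
  rw [← ENNReal.ofReal_mul (by positivity), norm_taylorCoeff_iteratedDeriv_sq, dirichletWeight]
  congr 1
  have := Nat.factorial_ne_zero k
  have := Nat.factorial_ne_zero m
  have := Nat.factorial_ne_zero (m + 1)
  rw [show k + m + 1 = k + (m + 1) by ring]
  have := Nat.factorial_ne_zero (k + (m + 1))
  field_simp

/-- For n = 0 the bound r^(2k) ≤ 1 in Parseval's identity gives an inequality in the limit, and only
this direction is needed. -/
lemma SmoothAnalytic.ofReal_dirichletInt_normArcLength_le (hf : SmoothAnalytic f) (n : ℕ) :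
    ENNReal.ofReal (dirichletInt normArcLength n f) ≤
      ∑' k, ENNReal.ofReal (dirichletWeight n k * ‖taylorCoeff f (k + n)‖ ^ 2) := by
  cases n with
  | succ m => exact (hf.ofReal_dirichletInt_normArcLength_succ m).le
  | zero =>
    have ht := hf.tendsto_dirichletTrunc_zero
    rw [← show dirichletInt normArcLength 0 f = _ from ht.limUnder_eq] at ht
    refine le_of_tendsto (ENNReal.tendsto_ofReal ht) ?_
    filter_upwards [Ioo_mem_nhdsLT one_pos] with r hr
    have h := hasSum_circleAverage_norm_sq hf.1 hr.1.le hr.2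
    have hr0 := hr.1.le
    rw [dirichletTrunc_normArcLength_zero hr.1.le hr.2, ← h.tsum_eq,
      ENNReal.ofReal_tsum_of_nonneg (fun k => by positivity) h.summable]
    refine ENNReal.tsum_le_tsum fun k => ENNReal.ofReal_le_ofReal ?_
    have hk : dirichletWeight 0 k = 1 := by
      have := Nat.factorial_ne_zero k
      simp [dirichletWeight, this]
    rw [hk, one_mul, add_zero]
    exact mul_le_of_le_one_right (by positivity) (pow_le_one₀ hr0 hr.2.le)

/-- Comparison of two quantities given by weighted sums of squares of Taylor coefficients. -/
lemma le_of_weighted_sums (f : ℂ → ℂ) (n : ℕ) {u v : ℕ → ℝ} {A D E : ℝ} (hE : 0 ≤ E)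
    (h0 : u 0 ≤ A) (hA : 0 ≤ A) (h : ∀ k, u (k + 1) ≤ A * v k)
    (hD : ENNReal.ofReal D ≤ ∑' k, ENNReal.ofReal (u k * ‖taylorCoeff f (k + n)‖ ^ 2))
    (hvE : ∑' k, ENNReal.ofReal (v k * ‖taylorCoeff f (k + (n + 1))‖ ^ 2) ≤ ENNReal.ofReal E) :
    D ≤ A * (‖taylorCoeff f n‖ ^ 2 + E) := by
  rw [← ENNReal.ofReal_le_ofReal_iff (by positivity)]
  refine hD.trans ?_
  -- The term k = 0 is the one in a_n, absent from the sum for E; the remaining terms are compared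
  -- after the shift k ↦ k+1.
  rw [tsum_eq_zero_add' ENNReal.summable, ENNReal.ofReal_mul hA,
    ENNReal.ofReal_add (by positivity) hE, mul_add, ← ENNReal.ofReal_mul hA, zero_add]
  refine add_le_add (ENNReal.ofReal_le_ofReal (by gcongr)) ?_
  refine le_trans ?_ (mul_le_mul_right hvE _)
  rw [← ENNReal.tsum_mul_left]
  refine ENNReal.tsum_le_tsum fun k => ?_
  rw [← ENNReal.ofReal_mul hA, ← mul_assoc, show k + 1 + n = k + (n + 1) by ring]
  exact ENNReal.ofReal_le_ofReal (by gcongr; exact h k)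

/-- The quotient of the two weights is (n+1)/(k+1). -/
lemma dirichletWeight_succ_le (n k : ℕ) :
    dirichletWeight n (k + 1) ≤ (n + 1) * dirichletWeight (n + 1) k := by
  have hk := Nat.factorial_pos k
  have hn := Nat.factorial_pos n
  rw [dirichletWeight, dirichletWeight, show k + 1 + n = k + (n + 1) by ring,
    Nat.factorial_succ k, Nat.factorial_succ n]
  push_cast
  rw [← mul_div_assoc, div_le_div_iff₀ (by positivity) (by positivity)]
  have : (0 : ℝ) < (k + (n + 1))! := by positivity
  have h1 : (1 : ℝ) ≤ k + 1 := by linarith [(Nat.cast_nonneg k : (0 : ℝ) ≤ k)]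
  calc ((k + (n + 1))! : ℝ) * (k ! * ((n + 1) * n !))
      = (n + 1) * (k + (n + 1))! * (1 * k ! * n !) := by ring
    _ ≤ _ := by gcongr

lemma SmoothAnalytic.dirichletInt_normArcLength_le (hf : SmoothAnalytic f) (m : ℕ) :
    dirichletInt normArcLength m f ≤
      (m + 1) * (‖taylorCoeff f m‖ ^ 2 + dirichletInt normArcLength (m + 1) f) :=
  le_of_weighted_sums f m (hf.dirichletInt_nonneg _ m)
    (by rw [dirichletWeight_zero_right]; linarith [(Nat.cast_nonneg m : (0 : ℝ) ≤ m)])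
    (by positivity) (dirichletWeight_succ_le m) (hf.ofReal_dirichletInt_normArcLength_le m)
    (hf.ofReal_dirichletInt_normArcLength_succ m).ge

lemma SmoothAnalytic.norm_taylorCoeff_sq_le (hf : SmoothAnalytic f) (m : ℕ) :
    ‖taylorCoeff f (m + 1)‖ ^ 2 ≤ dirichletInt normArcLength (m + 1) f := by
  rw [← ENNReal.ofReal_le_ofReal_iff (hf.dirichletInt_nonneg _ m),
    hf.ofReal_dirichletInt_normArcLength_succ]
  refine le_trans (le_of_eq ?_) (ENNReal.le_tsum 0)
  rw [dirichletWeight_zero_right, one_mul, zero_add]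

/-! ### Coefficient bounds for a general measure -/

variable (μ : Measure (sphere (0 : ℂ) 1)) [IsFiniteMeasure μ]

/-- The bound P_μ ≥ (μ(𝕋)/4)(1 - |z|²) leaves a radial weight with one more power of 1 - |z|², which
lowers the growth of the coefficient weights from k^(n+1) to k^n. -/
lemma SmoothAnalytic.tsum_le_ofReal_dirichletInt (hf : SmoothAnalytic f) (n : ℕ) :
    ∑' k, ENNReal.ofReal (μ.real Set.univ / 4 * ((k + (n + 1))! / (k ! * n ! * (k + n + 2))) *
      ‖taylorCoeff f (k + (n + 1))‖ ^ 2) ≤ ENNReal.ofReal (dirichletInt μ (n + 1) f) := by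
  have hle : ENNReal.ofReal (μ.real Set.univ / 4) *
      ∫⁻ z in ball (0 : ℂ) 1, ENNReal.ofReal (‖iteratedDeriv (n + 1) f z‖ ^ 2) *
        ENNReal.ofReal ((1 - ‖z‖ ^ 2) ^ (n + 1)) ≤
      ∫⁻ z in ball (0 : ℂ) 1, ENNReal.ofReal (‖iteratedDeriv (n + 1) f z‖ ^ 2) *
        ENNReal.ofReal (poissonExt μ z * (1 - ‖z‖ ^ 2) ^ n) := by
    rw [← lintegral_const_mul' _ _ ENNReal.ofReal_ne_top]
    refine setLIntegral_mono' measurableSet_ball fun z hz => ?_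
    have hz1 : ‖z‖ < 1 := by simpa using hz
    have h1 := one_sub_norm_sq_pos hz1
    rw [mul_left_comm, ← ENNReal.ofReal_mul (by positivity)]
    refine mul_le_mul_right (ENNReal.ofReal_le_ofReal ?_) _
    calc _ = μ.real Set.univ / 4 * (1 - ‖z‖ ^ 2) * (1 - ‖z‖ ^ 2) ^ n := by ring
      _ ≤ _ := by gcongr; exact le_poissonExt μ hz1
  rw [hf.ofReal_dirichletInt μ]
  refine le_trans (le_of_eq ?_) (mul_le_mul_right hle _)
  rw [lintegral_norm_sq_mul_one_sub_sq_pow (hf.differentiableOn_iteratedDeriv _), ← mul_assoc,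
    ← mul_assoc, ← ENNReal.ofReal_mul (by positivity), ← ENNReal.ofReal_mul (by positivity),
    ← ENNReal.tsum_mul_left]
  refine tsum_congr fun k => ?_
  rw [← ENNReal.ofReal_mul (by positivity), norm_taylorCoeff_iteratedDeriv_sq]
  congr 1
  have := Nat.factorial_ne_zero k
  have := Nat.factorial_ne_zero n
  have := Nat.factorial_ne_zero (n + 1)
  rw [Nat.factorial_succ (k + (n + 1))]
  have := Nat.factorial_ne_zero (k + (n + 1))
  push_cast
  have : (k + n + 2 : ℝ) ≠ 0 := by positivity
  have : (k + (n + 1) + 1 : ℝ) ≠ 0 := by positivity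
  field_simp
  ring

lemma SmoothAnalytic.dirichletInt_normArcLength_le_of_ne_zero (hμ : μ ≠ 0)
    (hf : SmoothAnalytic f) (n : ℕ) :
    dirichletInt normArcLength n f ≤ (4 / μ.real Set.univ * (n + 2) + 1) *
      (‖taylorCoeff f n‖ ^ 2 + dirichletInt μ (n + 1) f) := by
  have hM : 0 < μ.real Set.univ := by
    have : NeZero μ := ⟨hμ⟩
    exact measureReal_univ_pos
  refine le_of_weighted_sums f n (hf.dirichletInt_nonneg μ n) ?_ (by positivity)
    (fun k => ?_) (hf.ofReal_dirichletInt_normArcLength_le n)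
    (hf.tsum_le_ofReal_dirichletInt μ n)
  · rw [dirichletWeight_zero_right]
    exact le_add_of_nonneg_left (by positivity)
  · have hk := Nat.factorial_pos k
    have hn := Nat.factorial_pos n
    -- Apart from the factor μ(𝕋)/4, the quotient of the weights is (k+n+2)/(k+1) ≤ n+2. The summand
    -- 1 in the constant covers the term k = 0, whose weight is 1.
    calc dirichletWeight n (k + 1)
        ≤ 4 / μ.real Set.univ * (n + 2) *
          (μ.real Set.univ / 4 * ((k + (n + 1))! / (k ! * n ! * (k + n + 2)))) := by
          rw [dirichletWeight, show k + 1 + n = k + (n + 1) by ring, Nat.factorial_succ k]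
          push_cast
          have e : 4 / μ.real Set.univ * (n + 2) *
              (μ.real Set.univ / 4 * ((k + (n + 1))! / (k ! * n ! * (k + n + 2)))) =
              ((n + 2) * (k + (n + 1))! : ℝ) / (k ! * n ! * (k + n + 2)) := by
            field_simp
          rw [e, div_le_div_iff₀ (by positivity) (by positivity)]
          have h1 : (k + n + 2 : ℝ) ≤ (n + 2) * (k + 1) := by
            nlinarith [(Nat.cast_nonneg k : (0 : ℝ) ≤ k), (Nat.cast_nonneg n : (0 : ℝ) ≤ n)]
          calc ((k + (n + 1))! : ℝ) * (k ! * n ! * (k + n + 2))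
              ≤ (k + (n + 1))! * (k ! * n ! * ((n + 2) * (k + 1))) := by gcongr
            _ = _ := by ring
      _ ≤ _ := by gcongr; linarith

/-- At order 1 the pointwise bound on P_μ would leave the non-integrable weight 1/(1 - |z|²), so the
Carleson estimate takes its place. The 8 is (1/π) · 2π · 4. -/
lemma SmoothAnalytic.ofReal_dirichletInt_one_le (hf : SmoothAnalytic f) :
    ENNReal.ofReal (dirichletInt μ 1 f) ≤
      ∑' k : ℕ, ENNReal.ofReal (8 * μ.real Set.univ * (k + 1) ^ 2 *
        ‖taylorCoeff f (k + 1)‖ ^ 2) := by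
  have h := lintegral_norm_sq_mul_poissonExt_le μ (hf.differentiableOn_iteratedDeriv 1)
  rw [hf.ofReal_dirichletInt μ 0]
  simp only [pow_zero, mul_one, zero_add]
  refine (mul_le_mul_right h _).trans_eq ?_
  rw [← ofReal_measureReal, ← ENNReal.ofReal_ofNat 4, ← mul_assoc, ← mul_assoc,
    ← ENNReal.ofReal_mul (by positivity), ← ENNReal.ofReal_mul (by positivity),
    ← ENNReal.ofReal_mul (by positivity), ← ENNReal.tsum_mul_left]
  refine tsum_congr fun k => ?_
  rw [← ENNReal.ofReal_mul (by positivity), norm_taylorCoeff_iteratedDeriv_sq,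
    Nat.factorial_succ k]
  have := Nat.factorial_ne_zero k
  congr 1
  push_cast
  simp
  field_simp
  ring

/-- From order 2 on, one factor 1 - |z|² is available to absorb the bound P_μ ≤ 4μ(𝕋)/(1 - |z|²),
and the weight that remains is radial. -/
lemma SmoothAnalytic.ofReal_dirichletInt_add_two_le (hf : SmoothAnalytic f) (m : ℕ) :
    ENNReal.ofReal (dirichletInt μ (m + 2) f) ≤
      ∑' k : ℕ, ENNReal.ofReal (4 * μ.real Set.univ * ((k + (m + 2))! * (k + (m + 2)) /
        (k ! * (m + 2)! * (m + 1))) * ‖taylorCoeff f (k + (m + 2))‖ ^ 2) := by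
  have hle : ∫⁻ z in ball (0 : ℂ) 1, ENNReal.ofReal (‖iteratedDeriv (m + 2) f z‖ ^ 2) *
        ENNReal.ofReal (poissonExt μ z * (1 - ‖z‖ ^ 2) ^ (m + 1)) ≤
      ENNReal.ofReal (4 * μ.real Set.univ) *
      ∫⁻ z in ball (0 : ℂ) 1, ENNReal.ofReal (‖iteratedDeriv (m + 2) f z‖ ^ 2) *
        ENNReal.ofReal ((1 - ‖z‖ ^ 2) ^ m) := by
    rw [← lintegral_const_mul' _ _ ENNReal.ofReal_ne_top]
    refine setLIntegral_mono' measurableSet_ball fun z hz => ?_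
    have hz1 : ‖z‖ < 1 := by simpa using hz
    have h1 := one_sub_norm_sq_pos hz1
    rw [mul_left_comm (ENNReal.ofReal (4 * _)),
      ← ENNReal.ofReal_mul (p := 4 * μ.real Set.univ) (by positivity)]
    refine mul_le_mul_right (ENNReal.ofReal_le_ofReal ?_) _
    calc _ ≤ 4 * μ.real Set.univ / (1 - ‖z‖ ^ 2) * (1 - ‖z‖ ^ 2) ^ (m + 1) := by
          gcongr; exact poissonExt_le μ hz1
      _ = _ := by rw [pow_succ]; field_simp; ring
  rw [hf.ofReal_dirichletInt μ]
  refine (mul_le_mul_right hle _).trans_eq ?_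
  rw [lintegral_norm_sq_mul_one_sub_sq_pow (hf.differentiableOn_iteratedDeriv _), ← mul_assoc,
    ← mul_assoc, ← ENNReal.ofReal_mul (by positivity), ← ENNReal.ofReal_mul (by positivity),
    ← ENNReal.tsum_mul_left]
  refine tsum_congr fun k => ?_
  rw [← ENNReal.ofReal_mul (by positivity), norm_taylorCoeff_iteratedDeriv_sq]
  congr 1
  have := Nat.factorial_ne_zero k
  have := Nat.factorial_ne_zero m
  have := Nat.factorial_ne_zero (m + 2)
  rw [show k + (m + 2) = (k + m + 1) + 1 by ring, Nat.factorial_succ (k + m + 1),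
    Nat.factorial_succ m]
  have := Nat.factorial_ne_zero (k + m + 1)
  push_cast
  field_simp
  ring

lemma SmoothAnalytic.dirichletInt_one_le (hf : SmoothAnalytic f) :
    dirichletInt μ 1 f ≤ (32 * μ.real Set.univ + 1) *
      (‖taylorCoeff f 1‖ ^ 2 + dirichletInt normArcLength 2 f) := by
  have hM : 0 ≤ μ.real Set.univ := measureReal_nonneg
  refine le_of_weighted_sums f 1 (hf.dirichletInt_nonneg _ 1)
    (u := fun k => 8 * μ.real Set.univ * (k + 1) ^ 2) ?_ (by positivity) (fun k => ?_)
    (hf.ofReal_dirichletInt_one_le μ) (hf.ofReal_dirichletInt_normArcLength_succ 1).ge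
  · norm_num; linarith
  · have hw : dirichletWeight 2 k = (k + 2) * (k + 1) / 2 := by
      have := Nat.factorial_ne_zero k
      rw [dirichletWeight, Nat.factorial_succ (k + 1), Nat.factorial_succ k]
      push_cast
      simp
      field_simp
      ring
    rw [hw]
    push_cast
    have hk : (0 : ℝ) ≤ k := Nat.cast_nonneg k
    -- The 32 comes from k+2 ≤ 2(k+1), which gives 8(k+2)² ≤ 32 · (k+2)(k+1)/2.
    calc _ = μ.real Set.univ * (8 * (k + 1 + 1) ^ 2) := by ring
      _ ≤ μ.real Set.univ * (32 * ((k + 2) * (k + 1) / 2)) :=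
        mul_le_mul_of_nonneg_left (by nlinarith) hM
      _ ≤ _ := by
        have : 0 ≤ ((k + 2) * (k + 1) / 2 : ℝ) := by positivity
        nlinarith

lemma SmoothAnalytic.dirichletInt_add_two_le (hf : SmoothAnalytic f) (m : ℕ) :
    dirichletInt μ (m + 2) f ≤ (4 * μ.real Set.univ * (m + 3) ^ 2 + 1) *
      (‖taylorCoeff f (m + 2)‖ ^ 2 + dirichletInt normArcLength (m + 3) f) := by
  have hM : 0 ≤ μ.real Set.univ := measureReal_nonneg
  have hm0 : (0 : ℝ) ≤ m := Nat.cast_nonneg m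
  refine le_of_weighted_sums f (m + 2) (hf.dirichletInt_nonneg _ (m + 2))
    (u := fun k => 4 * μ.real Set.univ *
      ((k + (m + 2))! * (k + (m + 2)) / (k ! * (m + 2)! * (m + 1)))) ?_ (by positivity)
    (fun k => ?_) (hf.ofReal_dirichletInt_add_two_le μ m)
    (hf.ofReal_dirichletInt_normArcLength_succ (m + 2)).ge
  · have := Nat.factorial_ne_zero (m + 2)
    have e : ((0 + (m + 2))! * ((0 : ℕ) + (m + 2)) / (0 ! * (m + 2)! * (m + 1)) : ℝ) =
        (m + 2) / (m + 1) := by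
      simp
      field_simp
    rw [e]
    have h2 : (m + 2 : ℝ) / (m + 1) ≤ (m + 3) ^ 2 := by
      rw [div_le_iff₀ (by positivity)]; nlinarith
    calc _ ≤ 4 * μ.real Set.univ * (m + 3) ^ 2 := by gcongr
      _ ≤ _ := by linarith
  · have hk0 : (0 : ℝ) ≤ k := Nat.cast_nonneg k
    have hk := Nat.factorial_pos k
    have hm := Nat.factorial_pos (m + 2)
    have hw := dirichletWeight_nonneg (m + 3) k
    -- The quotient of the weights is (m+3)(k+m+3)/((k+1)(m+1)), and k+m+3 ≤ (m+3)(k+1)(m+1).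
    have h2 : ((k + 1 + (m + 2))! * ((k + 1 : ℕ) + (m + 2)) / ((k + 1)! * (m + 2)! * (m + 1)) : ℝ) ≤
        (m + 3) ^ 2 * dirichletWeight (m + 3) k := by
      rw [dirichletWeight, show k + 1 + (m + 2) = k + (m + 3) by ring, Nat.factorial_succ k,
        Nat.factorial_succ (m + 2), ← mul_div_assoc, div_le_div_iff₀ (by positivity) (by positivity)]
      push_cast
      have h1 : (k + 1 + (m + 2) : ℝ) ≤ (m + 3) * (k + 1) * (m + 1) := by
        nlinarith [mul_nonneg hk0 hm0, mul_nonneg (mul_nonneg hk0 hm0) hm0]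
      calc ((k + (m + 3))! * (k + 1 + (m + 2)) * (k ! * ((m + 2 + 1) * (m + 2)!)) : ℝ)
          ≤ (k + (m + 3))! * ((m + 3) * (k + 1) * (m + 1)) * (k ! * ((m + 2 + 1) * (m + 2)!)) := by
            gcongr
        _ = _ := by ring
    calc _ ≤ 4 * μ.real Set.univ * ((m + 3) ^ 2 * dirichletWeight (m + 3) k) := by gcongr
      _ ≤ _ := by linarith

end

/-! ### The main theorem -/

theorem proposition4p5 (μ : Measure (sphere (0 : ℂ) 1)) [IsFiniteMeasure μ] (hμ : μ ≠ 0) :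
    -- the Dirichlet integrals involved are well defined: the defining limits exist
    (∀ (n : ℕ) (f : ℂ → ℂ), SmoothAnalytic f →
      Tendsto (dirichletTrunc normArcLength n f) (𝓝[<] 1) (𝓝 (dirichletInt normArcLength n f))) ∧
    (∀ (n : ℕ) (f : ℂ → ℂ), 1 ≤ n → SmoothAnalytic f →
      Tendsto (dirichletTrunc μ n f) (𝓝[<] 1) (𝓝 (dirichletInt μ n f))) ∧
    -- (i)
    (∀ n : ℕ, ∃ C : ℝ, 0 < C ∧ ∀ f : ℂ → ℂ, SmoothAnalytic f →
      dirichletInt normArcLength n f ≤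
        C * (‖circleCoeff f n‖ ^ 2 + dirichletInt μ (n + 1) f)) ∧
    -- (ii), the estimate
    (∀ n : ℕ, 1 ≤ n → ∃ C : ℝ, 0 < C ∧ ∀ f : ℂ → ℂ, SmoothAnalytic f →
      dirichletInt μ n f ≤
        C * (‖circleCoeff f n‖ ^ 2 + dirichletInt normArcLength (n + 1) f)) ∧
    -- (ii), the comparability
    (∀ n : ℕ, 1 ≤ n → ∃ c C : ℝ, 0 < c ∧ 0 < C ∧ ∀ f : ℂ → ℂ, SmoothAnalytic f →
      c * (dirichletInt normArcLength n f + dirichletInt normArcLength (n + 1) f) ≤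
        ‖circleCoeff f n‖ ^ 2 + dirichletInt normArcLength (n + 1) f ∧
      ‖circleCoeff f n‖ ^ 2 + dirichletInt normArcLength (n + 1) f ≤
        C * (dirichletInt normArcLength n f + dirichletInt normArcLength (n + 1) f)) := by
  refine ⟨fun n f hf => ?_, fun n f hn hf => ?_, fun n => ?_, fun n hn => ?_, fun n hn => ?_⟩
  · cases n with
    | zero =>
      exact (show dirichletInt normArcLength 0 f = _ from
        hf.tendsto_dirichletTrunc_zero.limUnder_eq) ▸ hf.tendsto_dirichletTrunc_zero
    | succ m => exact hf.dirichletInt_eq normArcLength m ▸ hf.tendsto_dirichletTrunc normArcLength m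
  · obtain ⟨m, rfl⟩ := Nat.exists_eq_add_of_le' hn
    exact hf.dirichletInt_eq μ m ▸ hf.tendsto_dirichletTrunc μ m
  · refine ⟨4 / μ.real Set.univ * (n + 2) + 1, by positivity, fun f hf => ?_⟩
    rw [hf.circleCoeff_eq]
    exact hf.dirichletInt_normArcLength_le_of_ne_zero μ hμ n
  · obtain ⟨m, rfl⟩ := Nat.exists_eq_add_of_le' hn
    cases m with
    | zero =>
      refine ⟨32 * μ.real Set.univ + 1, by positivity, fun f hf => ?_⟩
      rw [hf.circleCoeff_eq]
      exact hf.dirichletInt_one_le μ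
    | succ m =>
      refine ⟨4 * μ.real Set.univ * (m + 3) ^ 2 + 1, by positivity, fun f hf => ?_⟩
      rw [hf.circleCoeff_eq]
      exact hf.dirichletInt_add_two_le μ m
  · obtain ⟨m, rfl⟩ := Nat.exists_eq_add_of_le' hn
    -- With n = m+1, adding D_{λ,n+1} to D_{λ,n} ≤ (n+1)(|a_n|² + D_{λ,n+1}) gives the factor n+2 =
    -- m+3. The upper constant 1 holds because |a_n|² is the first term of D_{λ,n}.
    refine ⟨1 / (m + 3), 1, by positivity, one_pos, fun f hf => ?_⟩
    rw [hf.circleCoeff_eq]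
    have h1 := hf.dirichletInt_normArcLength_le (m + 1)
    have h2 := hf.norm_taylorCoeff_sq_le m
    push_cast at h1
    constructor
    · rw [one_div, inv_mul_le_iff₀ (by positivity)]
      nlinarith [sq_nonneg ‖taylorCoeff f (m + 1)‖]
    · linarith
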